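/- Let $d\ge 3$ be an integer, let $a,b\in\mathbb R$ satisfy $a<b<a+1$ and $a<\frac{d-2}{2}$, and put $$p=\frac{2d}{d-2+2(b-a)},\qquad n=\frac{d}{1+a-b}\in(d,\infty),\qquad \alpha=1+a-\frac{pb}{2}>0 .$$ Given a $d$-dimensional weighted Riemannian manifold $(M,\mathfrak g,\mu)$, where $\mathfrak g=(\mathfrak g^{ij})$ is the inverse of the metric, write $d\mu=e^{-W}dV_{\mathfrak g}$ with $dV_{\mathfrak g}$ the Riemannian volume and $W\in C^\infty(M)$, let $\Gamma(f)=|\nabla f|^2_{\mathfrak g}$ be the carré du champ, $\Delta_{\mathfrak g}$ the Laplace–Beltrami operator, $sc_{\mathfrak g}$ the scalar curvature, and for $\gamma\in\mathbb R$ set $$S_\gamma(\mu,\Gamma)=\theta_n(\gamma)\bigl[sc_{\mathfrak g}-\gamma\,\Delta_{\mathfrak g}W+\beta_n(\gamma)\,\Gamma(W)\bigr],$$ $$\beta_n(\gamma)=\frac{\gamma(n-2d+2)-2(d-1)}{2(n-d)},\qquad \theta_n(\gamma)=\frac{n-2}{4(d-1)-2\gamma(n-d)} .$$ Consider the following three weighted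 Riemannian manifolds. - The Euclidean CKN space: $\mathbb R^d\setminus\{0\}$ with $\hat{\mathfrak g}^{ij}=|x|^{2(1-\alpha)}\delta^{ij}$ and $d\hat\mu=|x|^{-bp}dx$. - The spherical CKN space: $\mathbb R^d\setminus\{0\}$ with $\bar{\mathfrak g}^{ij}=|x|^{2(1-\alpha)}\frac{(1+|x|^{2\alpha})^2}{4}\delta^{ij}$ and $d\bar\mu=2^n\frac{|x|^{-bp}}{(1+|x|^{2\alpha})^n}dx$. - The hyperbolic CKN space: $B\setminus\{0\}$, where $B$ is the open unit ball of $\mathbb R^d$, with $\tilde{\mathfrak g}^{ij}=|x|^{2(1-\alpha)}\frac{(1-|x|^{2\alpha})^2}{4}\delta^{ij}$ and $d\tilde\mu=2^n\frac{|x|^{-bp}}{(1-|x|^{2\alpha})^n}dx$. Let $\hat\Gamma,\bar\Gamma,\tilde\Gamma$ be the respective carré du champ operators, and let $$\mathfrak B_{DGZ}=(d-2)-(n-2)\alpha^2,\qquad \gamma_0=-\frac{2(d-1)}{\alpha^2(n-d)(n-2)}\,\mathfrak B_{DGZ}.$$ Then, at every point of the respective manifold, $$S_{\gamma_0}(\hat\mu,\hat\Gamma)=0,\qquad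 S_{\gamma_0}(\bar\mu,\bar\Gamma)=\frac{n(n-2)}{4}\alpha^2,\qquad S_{\gamma_0}(\tilde\mu,\tilde\Gamma)=-\frac{n(n-2)}{4}\alpha^2 .$$ -/

import Mathlib

open MeasureTheory Set
open scoped ContDiff

noncomputable section

/-! ### Weighted Riemannian manifolds in one global chart -/

/-- `i`-th partial derivative of a function on `ℝ^d`. -/
def pd {d : ℕ} (i : Fin d) (f : EuclideanSpace ℝ (Fin d) → ℝ)
    (x : EuclideanSpace ℝ (Fin d)) : ℝ :=
  fderiv ℝ f x (EuclideanSpace.single i 1)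

/-- Riemannian volume of the metric `g = 𝔤⁻¹` on `U`: the measure `√(det g) dx` on `U`. -/
def riemannianVolume {d : ℕ} (U : Set (EuclideanSpace ℝ (Fin d)))
    (𝔤 : EuclideanSpace ℝ (Fin d) → Matrix (Fin d) (Fin d) ℝ) :
    Measure (EuclideanSpace ℝ (Fin d)) :=
  (volume.restrict U).withDensity (fun x => ENNReal.ofReal (Real.sqrt ((𝔤 x)⁻¹).det))

/-- `W` is a smooth weight of `μ`: `dμ = e^{-W} dV_g` on `U`. -/
def IsWeight {d : ℕ} (U : Set (EuclideanSpace ℝ (Fin d)))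
    (𝔤 : EuclideanSpace ℝ (Fin d) → Matrix (Fin d) (Fin d) ℝ)
    (μ : Measure (EuclideanSpace ℝ (Fin d))) (W : EuclideanSpace ℝ (Fin d) → ℝ) : Prop :=
  ContDiffOn ℝ ∞ W U ∧
    μ = (riemannianVolume U 𝔤).withDensity (fun x => ENNReal.ofReal (Real.exp (-W x)))

/-- A weighted Riemannian manifold `(M, 𝔤, μ)`, where `M` is an open subset of `ℝ^d`. The metric
is given by its matrix `𝔤^{ij}` with upper indices; `μ` has a smooth positive density with
respect to the Riemannian volume. -/
structure WeightedSpace (d : ℕ) where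
  carrier : Set (EuclideanSpace ℝ (Fin d))
  isOpen_carrier : IsOpen carrier
  cometric : EuclideanSpace ℝ (Fin d) → Matrix (Fin d) (Fin d) ℝ
  contDiffOn_cometric : ∀ i j, ContDiffOn ℝ ∞ (fun x => cometric x i j) carrier
  posDef_cometric : ∀ x ∈ carrier, (cometric x).PosDef
  μ : Measure (EuclideanSpace ℝ (Fin d))
  exists_weight : ∃ W, IsWeight carrier cometric μ W

namespace WeightedSpace

variable {d : ℕ} (X : WeightedSpace d)

/-- The metric `g_{ij}` with lower indices. -/
def metric (x : EuclideanSpace ℝ (Fin d)) : Matrix (Fin d) (Fin d) ℝ := (X.cometric x)⁻¹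

/-- The weight `W`, defined by `dμ = e^{-W} dV_g`; it is unique on the manifold,
see `weight_unique` below. -/
def weight : EuclideanSpace ℝ (Fin d) → ℝ := X.exists_weight.choose

/-- The carré du champ `Γ(f) = |∇f|² = 𝔤^{ij} ∂_i f ∂_j f`. -/
def carreDuChamp (f : EuclideanSpace ℝ (Fin d) → ℝ) (x : EuclideanSpace ℝ (Fin d)) : ℝ :=
  ∑ i, ∑ j, X.cometric x i j * pd i f x * pd j f x

/-- The Laplace–Beltrami operator `Δf = (det g)^{-1/2} ∂_i ((det g)^{1/2} 𝔤^{ij} ∂_j f)`. -/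
def laplaceBeltrami (f : EuclideanSpace ℝ (Fin d) → ℝ) (x : EuclideanSpace ℝ (Fin d)) : ℝ :=
  (Real.sqrt (X.metric x).det)⁻¹ *
    ∑ i, pd i (fun y => ∑ j, Real.sqrt (X.metric y).det * X.cometric y i j * pd j f y) x

/-- Christoffel symbols `Γ^k_{ij}` of the Levi-Civita connection. -/
def christoffel (k i j : Fin d) (x : EuclideanSpace ℝ (Fin d)) : ℝ :=
  ∑ l, (1 / 2 : ℝ) * X.cometric x k l *
    (pd i (fun y => X.metric y j l) x + pd j (fun y => X.metric y i l) x
      - pd l (fun y => X.metric y i j) x)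

/-- Riemann curvature
`R^l_{ijk} = ∂_j Γ^l_{ik} - ∂_k Γ^l_{ij} + Γ^l_{jm} Γ^m_{ik} - Γ^l_{km} Γ^m_{ij}`. -/
def riemann (l i j k : Fin d) (x : EuclideanSpace ℝ (Fin d)) : ℝ :=
  pd j (X.christoffel l i k) x - pd k (X.christoffel l i j) x
    + ∑ m, (X.christoffel l j m x * X.christoffel m i k x
      - X.christoffel l k m x * X.christoffel m i j x)

/-- Ricci curvature `Ric_{ik} = R^l_{ilk}`. -/
def ricci (i k : Fin d) (x : EuclideanSpace ℝ (Fin d)) : ℝ := ∑ l, X.riemann l i l k x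

/-- Scalar curvature `sc = 𝔤^{ik} Ric_{ik}` (positive on round spheres). -/
def scalarCurvature (x : EuclideanSpace ℝ (Fin d)) : ℝ :=
  ∑ i, ∑ k, X.cometric x i k * X.ricci i k x

end WeightedSpace

/-- `β_n(γ)`, for topological dimension `d`. -/
def betaCoeff (d : ℕ) (n γ : ℝ) : ℝ :=
  (γ * (n - 2 * d + 2) - 2 * (d - 1)) / (2 * (n - d))

/-- `θ_n(γ)`, for topological dimension `d`. -/
def thetaCoeff (d : ℕ) (n γ : ℝ) : ℝ :=
  (n - 2) / (4 * (d - 1) - 2 * γ * (n - d))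

/-- The function `S_γ(μ, Γ) = θ_n(γ) [sc - γ ΔW + β_n(γ) Γ(W)]`. -/
def WeightedSpace.invariantS {d : ℕ} (X : WeightedSpace d) (n γ : ℝ)
    (x : EuclideanSpace ℝ (Fin d)) : ℝ :=
  thetaCoeff d n γ * (X.scalarCurvature x - γ * X.laplaceBeltrami X.weight x
    + betaCoeff d n γ * X.carreDuChamp X.weight x)

/-! ### Uniqueness of the weight, and metrics of the form `𝔤^{ij} = q δ^{ij}` -/

theorem isWeight_iff {d : ℕ} {U : Set (EuclideanSpace ℝ (Fin d))} (hU : IsOpen U)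
    {𝔤 : EuclideanSpace ℝ (Fin d) → Matrix (Fin d) (Fin d) ℝ}
    (h𝔤 : ∀ i j, ContDiffOn ℝ ∞ (fun x => 𝔤 x i j) U) (hpos : ∀ x ∈ U, (𝔤 x).PosDef)
    {μ : Measure (EuclideanSpace ℝ (Fin d))} {W : EuclideanSpace ℝ (Fin d) → ℝ} :
    IsWeight U 𝔤 μ W ↔ ContDiffOn ℝ ∞ W U ∧ μ = (volume.restrict U).withDensity
      (fun x => ENNReal.ofReal (Real.sqrt ((𝔤 x)⁻¹).det * Real.exp (-W x))) := by
  unfold IsWeight riemannianVolume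
  refine and_congr_right fun hW => ?_
  have hdet : ContinuousOn (fun x => (𝔤 x).det) U := by
    have : ContinuousOn 𝔤 U := continuousOn_pi.2 fun i => continuousOn_pi.2 fun j =>
      (h𝔤 i j).continuousOn
    exact (Continuous.matrix_det continuous_id).comp_continuousOn this
  have h1 : ContinuousOn (fun x => Real.sqrt ((𝔤 x)⁻¹).det) U := by
    refine Real.continuous_sqrt.comp_continuousOn ?_
    simp only [Matrix.det_nonsing_inv, Ring.inverse_eq_inv']
    exact hdet.inv₀ fun x hx => (hpos x hx).det_pos.ne'
  have h2 : ContinuousOn (fun x => Real.exp (-W x)) U :=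
    Real.continuous_exp.comp_continuousOn hW.continuousOn.neg
  have m1 := ENNReal.continuous_ofReal.comp_continuousOn h1
    |>.aemeasurable hU.measurableSet (μ := volume)
  have m2 := ENNReal.continuous_ofReal.comp_continuousOn h2
    |>.aemeasurable hU.measurableSet (μ := volume)
  have := withDensity_mul₀ m1 m2
  simp only [Function.comp_def] at this
  rw [← this]
  simp only [Pi.mul_def, ENNReal.ofReal_mul (Real.sqrt_nonneg _)]

theorem WeightedSpace.weight_isWeight {d : ℕ} (X : WeightedSpace d) :
    IsWeight X.carrier X.cometric X.μ X.weight := X.exists_weight.choose_spec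

theorem WeightedSpace.weight_unique {d : ℕ} (X : WeightedSpace d)
    {W : EuclideanSpace ℝ (Fin d) → ℝ} (hW : IsWeight X.carrier X.cometric X.μ W) :
    EqOn X.weight W X.carrier := by
  have hV := X.weight_isWeight
  rw [isWeight_iff X.isOpen_carrier X.contDiffOn_cometric X.posDef_cometric] at hV hW
  have hdet : ContinuousOn (fun x => (X.cometric x).det) X.carrier := by
    have : ContinuousOn X.cometric X.carrier := continuousOn_pi.2 fun i =>
      continuousOn_pi.2 fun j => (X.contDiffOn_cometric i j).continuousOn
    exact (Continuous.matrix_det continuous_id).comp_continuousOn this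
  have h1 : ContinuousOn (fun x => Real.sqrt ((X.cometric x)⁻¹).det) X.carrier := by
    refine Real.continuous_sqrt.comp_continuousOn ?_
    simp only [Matrix.det_nonsing_inv, Ring.inverse_eq_inv']
    exact hdet.inv₀ fun x hx => (X.posDef_cometric x hx).det_pos.ne'
  have key : ∀ V : EuclideanSpace ℝ (Fin d) → ℝ, ContDiffOn ℝ ∞ V X.carrier →
      ContinuousOn (fun x => ENNReal.ofReal
        (Real.sqrt ((X.cometric x)⁻¹).det * Real.exp (-V x))) X.carrier := fun V hV =>
    ENNReal.continuous_ofReal.comp_continuousOn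
      (h1.mul (Real.continuous_exp.comp_continuousOn hV.continuousOn.neg))
  have hae := (withDensity_eq_iff_of_sigmaFinite
    ((key _ hV.1).aemeasurable X.isOpen_carrier.measurableSet)
    ((key _ hW.1).aemeasurable X.isOpen_carrier.measurableSet)).1 (hV.2.symm.trans hW.2)
  have heq := Measure.eqOn_open_of_ae_eq hae X.isOpen_carrier (key _ hV.1) (key _ hW.1)
  intro x hx
  have hs : 0 < Real.sqrt ((X.cometric x)⁻¹).det :=
    Real.sqrt_pos.2 (X.posDef_cometric x hx).inv.det_pos
  have := heq hx
  simp only at this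
  rw [ENNReal.ofReal_eq_ofReal_iff (by positivity) (by positivity)] at this
  have := Real.exp_injective (mul_left_cancel₀ hs.ne' this)
  linarith

/-- The weighted space with `𝔤^{ij} = q δ^{ij}` and `dμ = m dx` on the open set `U`. -/
def WeightedSpace.ofScalar {d : ℕ} (U : Set (EuclideanSpace ℝ (Fin d))) (hU : IsOpen U)
    (q m : EuclideanSpace ℝ (Fin d) → ℝ) (hq : ContDiffOn ℝ ∞ q U) (hq0 : ∀ x ∈ U, 0 < q x)
    (hm : ContDiffOn ℝ ∞ m U) (hm0 : ∀ x ∈ U, 0 < m x) : WeightedSpace d where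
  carrier := U
  isOpen_carrier := hU
  cometric x := q x • (1 : Matrix (Fin d) (Fin d) ℝ)
  contDiffOn_cometric i j := by
    simp only [Matrix.smul_apply, smul_eq_mul]
    exact hq.mul contDiffOn_const
  posDef_cometric x hx := Matrix.PosDef.one.smul (hq0 x hx)
  μ := (volume.restrict U).withDensity (fun x => ENNReal.ofReal (m x))
  exists_weight := by
    have hdet : ∀ x, ((q x • (1 : Matrix (Fin d) (Fin d) ℝ))⁻¹).det = (q x ^ d)⁻¹ := fun x => by
      rw [Matrix.det_nonsing_inv, Ring.inverse_eq_inv', Matrix.det_smul]; simp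
    have hs : ∀ x ∈ U, 0 < Real.sqrt (q x ^ d)⁻¹ := fun x hx =>
      Real.sqrt_pos.2 (inv_pos.2 (pow_pos (hq0 x hx) d))
    refine ⟨fun x => -Real.log (m x / Real.sqrt (q x ^ d)⁻¹), ?_⟩
    rw [isWeight_iff hU (fun i j => by
      simp only [Matrix.smul_apply, smul_eq_mul]
      exact hq.mul contDiffOn_const) (fun x hx => Matrix.PosDef.one.smul (hq0 x hx))]
    constructor
    · refine (ContDiffOn.log (hm.div (ContDiffOn.sqrt ((hq.pow d).inv ?_) ?_) ?_) ?_).neg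
      · exact fun x hx => (pow_pos (hq0 x hx) d).ne'
      · exact fun x hx => (inv_pos.2 (pow_pos (hq0 x hx) d)).ne'
      · exact fun x hx => (hs x hx).ne'
      · exact fun x hx => (div_pos (hm0 x hx) (hs x hx)).ne'
    · refine withDensity_congr_ae ?_
      filter_upwards [ae_restrict_mem hU.measurableSet] with x hx
      rw [hdet, neg_neg, Real.exp_log (div_pos (hm0 x hx) (hs x hx)),
        mul_div_cancel₀ _ (hs x hx).ne']

/-! ### The CKN spaces -/

namespace CKN

/-- The critical exponent `p`. -/
def p (d : ℕ) (a b : ℝ) : ℝ := 2 * d / (d - 2 + 2 * (b - a))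

/-- The intrinsic dimension `n`. -/
def n (d : ℕ) (a b : ℝ) : ℝ := d / (1 + a - b)

/-- The parameter `α`. -/
def α (d : ℕ) (a b : ℝ) : ℝ := 1 + a - p d a b * b / 2

/-- The constant `𝔅_DGZ`. -/
def bDGZ (d : ℕ) (a b : ℝ) : ℝ := (d - 2) - (n d a b - 2) * α d a b ^ 2

/-- The value `γ₀`. -/
def γ₀ (d : ℕ) (a b : ℝ) : ℝ :=
  -(2 * (d - 1) / (α d a b ^ 2 * (n d a b - d) * (n d a b - 2))) * bDGZ d a b

theorem α_pos {d : ℕ} {a b : ℝ} (hd : 3 ≤ d) (hab : a ≤ b) (hba : b < a + 1)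
    (ha : a < ((d : ℝ) - 2) / 2) : 0 < α d a b := by
  have hd' : (3 : ℝ) ≤ d := by exact_mod_cast hd
  have h : (0 : ℝ) < d - 2 + 2 * (b - a) := by linarith
  have : α d a b = 2 * (((d : ℝ) - 2) / 2 - a) * (a + 1 - b) / (d - 2 + 2 * (b - a)) := by
    unfold α p
    field_simp
    ring
  rw [this]
  exact div_pos (mul_pos (by linarith) (by linarith)) h

theorem contDiffOn_norm_rpow {d : ℕ} (s : ℝ) {U : Set (EuclideanSpace ℝ (Fin d))}
    (hU : ∀ x ∈ U, x ≠ 0) : ContDiffOn ℝ ∞ (fun x => ‖x‖ ^ s) U := fun x hx =>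
  ((contDiffAt_norm ℝ (hU x hx)).rpow_const_of_ne
    (norm_ne_zero_iff.2 (hU x hx))).contDiffWithinAt

/-- The Euclidean CKN space, on `ℝ^d \ {0}`. -/
def euclidean (d : ℕ) (a b : ℝ) : WeightedSpace d :=
  WeightedSpace.ofScalar {0}ᶜ isOpen_compl_singleton
    (fun x => ‖x‖ ^ (2 * (1 - α d a b)))
    (fun x => ‖x‖ ^ (-(b * p d a b)))
    (contDiffOn_norm_rpow _ fun _ hx => hx)
    (fun _ hx => Real.rpow_pos_of_pos (norm_pos_iff.2 hx) _)
    (contDiffOn_norm_rpow _ fun _ hx => hx)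
    (fun _ hx => Real.rpow_pos_of_pos (norm_pos_iff.2 hx) _)

/-- The spherical CKN space, on `ℝ^d \ {0}`. -/
def spherical (d : ℕ) (a b : ℝ) : WeightedSpace d :=
  WeightedSpace.ofScalar {0}ᶜ isOpen_compl_singleton
    (fun x => ‖x‖ ^ (2 * (1 - α d a b)) * ((1 + ‖x‖ ^ (2 * α d a b)) ^ 2 / 4))
    (fun x => 2 ^ n d a b * (‖x‖ ^ (-(b * p d a b)) / (1 + ‖x‖ ^ (2 * α d a b)) ^ n d a b))
    ((contDiffOn_norm_rpow _ fun _ hx => hx).mul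
      (((contDiffOn_const.add (contDiffOn_norm_rpow _ fun _ hx => hx)).pow 2).div_const 4))
    (fun x hx => by
      have := norm_pos_iff.2 hx
      positivity)
    (contDiffOn_const.mul ((contDiffOn_norm_rpow _ fun _ hx => hx).div
      ((contDiffOn_const.add (contDiffOn_norm_rpow _ fun _ hx => hx)).rpow_const_of_ne
        fun x _ => by positivity)
      fun x _ => by positivity))
    (fun x hx => by
      have := norm_pos_iff.2 hx
      positivity)

theorem one_sub_pos {d : ℕ} {s : ℝ} (hs : 0 < s) {x : EuclideanSpace ℝ (Fin d)}
    (hx : x ∈ Metric.ball (0 : EuclideanSpace ℝ (Fin d)) 1 \ {0}) :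
    0 < 1 - ‖x‖ ^ (2 * s) :=
  sub_pos.2 (Real.rpow_lt_one (norm_nonneg x) (mem_ball_zero_iff.1 hx.1) (by positivity))

/-- The hyperbolic CKN space, on the punctured open unit ball (for `α > 0`). -/
def hyperbolic (d : ℕ) (a b : ℝ) (hα : 0 < α d a b) : WeightedSpace d :=
  WeightedSpace.ofScalar (Metric.ball 0 1 \ {0})
    (Metric.isOpen_ball.sdiff isClosed_singleton)
    (fun x => ‖x‖ ^ (2 * (1 - α d a b)) * ((1 - ‖x‖ ^ (2 * α d a b)) ^ 2 / 4))
    (fun x => 2 ^ n d a b * (‖x‖ ^ (-(b * p d a b)) / (1 - ‖x‖ ^ (2 * α d a b)) ^ n d a b))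
    ((contDiffOn_norm_rpow _ fun _ hx => hx.2).mul
      (((contDiffOn_const.sub (contDiffOn_norm_rpow _ fun _ hx => hx.2)).pow 2).div_const 4))
    (fun x hx => by
      have := norm_pos_iff.2 hx.2
      have := one_sub_pos hα hx
      positivity)
    (contDiffOn_const.mul ((contDiffOn_norm_rpow _ fun _ hx => hx.2).div
      ((contDiffOn_const.sub (contDiffOn_norm_rpow _ fun _ hx => hx.2)).rpow_const_of_ne
        fun x hx => (one_sub_pos hα hx).ne')
      fun x hx => (Real.rpow_pos_of_pos (one_sub_pos hα hx) _).ne'))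
    (fun x hx => by
      have := norm_pos_iff.2 hx.2
      have := one_sub_pos hα hx
      positivity)

end CKN

end

/-! All three cometrics are `q δ^{ij}` with `q` radial, so the curvature, the Laplacian and the
carré du champ reduce to Euclidean divergences and inner products of `w = ∇(log q)/2` and `∇W`. The
cases are unified by a sign `ε ∈ {0, 1, -1}`. Put `ρ = |x|²`, `c = (1 - ε ρ^α)/(1 + ε ρ^α)` and `T =
q/ρ`. Then `w = (1 - αc) x/ρ`, `∇W = -(n - d)αc x/ρ`, `ρ c' = -α(1 - c²)/2` and `T(1 - c²) = ε`. The
terms linear in `c` cancel: `sc = T(d-1)[(d-2)(1 - α²c²) + 2α²(1 - c²)]`, `ΔW = T(n-d)α²[(1 - c²) -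
(d-2)c²]`, `Γ(W) = T(n-d)²α²c²`. The bracket in `S_γ` is thus `T(A + Bc²)` with constants `A`, `B`.
It is a multiple of `T(1 - c²) = ε`, hence constant, as soon as it vanishes at `c² = 1`, and `γ₀` is
exactly the root of this condition, which is linear in `γ`. Then `A = (d-1)(d-2)n/(n-2)`, and
multiplying by `θ_n(γ₀)` gives `n(n-2)α²/4`. `scalarCurvature_eq` and `laplaceBeltrami_eq` carry the
geometry, `invariantS_of_radial` the algebra, and `invariantS_ofScalar` supplies `c` and `∇W`. -/

open Filter Topology

/-! ### Partial derivatives -/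

theorem pd_congr {d : ℕ} {f g : EuclideanSpace ℝ (Fin d) → ℝ} {x : EuclideanSpace ℝ (Fin d)}
    (h : f =ᶠ[𝓝 x] g) (i : Fin d) : pd i f x = pd i g x := by
  unfold pd
  rw [h.fderiv_eq]

theorem pd_const_mul {d : ℕ} {f : EuclideanSpace ℝ (Fin d) → ℝ} {x : EuclideanSpace ℝ (Fin d)}
    (hf : DifferentiableAt ℝ f x) (c : ℝ) (i : Fin d) :
    pd i (fun y => c * f y) x = c * pd i f x := by
  unfold pd
  rw [fderiv_const_mul hf]
  rfl

theorem pd_add {d : ℕ} {f g : EuclideanSpace ℝ (Fin d) → ℝ} {x : EuclideanSpace ℝ (Fin d)}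
    (hf : DifferentiableAt ℝ f x) (hg : DifferentiableAt ℝ g x) (i : Fin d) :
    pd i (fun y => f y + g y) x = pd i f x + pd i g x := by
  unfold pd
  rw [fderiv_fun_add hf hg]
  rfl

theorem pd_mul {d : ℕ} {f g : EuclideanSpace ℝ (Fin d) → ℝ} {x : EuclideanSpace ℝ (Fin d)}
    (hf : DifferentiableAt ℝ f x) (hg : DifferentiableAt ℝ g x) (i : Fin d) :
    pd i (fun y => f y * g y) x = pd i f x * g x + f x * pd i g x := by
  unfold pd
  rw [fderiv_fun_mul hf hg]
  simp
  ring

theorem pd_comp {d : ℕ} {f : EuclideanSpace ℝ (Fin d) → ℝ} {x : EuclideanSpace ℝ (Fin d)}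
    {h : ℝ → ℝ} {h' : ℝ} (hh : HasDerivAt h h' (f x)) (hf : DifferentiableAt ℝ f x) (i : Fin d) :
    pd i (fun y => h (f y)) x = h' * pd i f x := by
  unfold pd
  have : HasFDerivAt (fun y => h (f y)) (h' • fderiv ℝ f x) x :=
    hh.comp_hasFDerivAt x hf.hasFDerivAt
  rw [this.fderiv]
  rfl

theorem pd_coord {d : ℕ} (i j : Fin d) (x : EuclideanSpace ℝ (Fin d)) :
    pd i (fun y => y j) x = if j = i then 1 else 0 := by
  unfold pd
  have : HasFDerivAt (fun y : EuclideanSpace ℝ (Fin d) => y j)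
      (EuclideanSpace.proj (𝕜 := ℝ) j) x := (EuclideanSpace.proj (𝕜 := ℝ) j).hasFDerivAt
  rw [this.fderiv]
  simp

theorem pd_norm_sq {d : ℕ} (i : Fin d) (x : EuclideanSpace ℝ (Fin d)) :
    pd i (fun y => ‖y‖ ^ 2) x = 2 * x i := by
  unfold pd
  rw [(hasStrictFDerivAt_norm_sq x).hasFDerivAt.fderiv]
  simp [EuclideanSpace.inner_single_right]

/-- Taking `|x|²` rather than `|x|` as radial variable keeps square roots out of every later
derivative. -/
theorem pd_radial {d : ℕ} {h : ℝ → ℝ} {h' : ℝ} {x : EuclideanSpace ℝ (Fin d)}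
    (hh : HasDerivAt h h' (‖x‖ ^ 2)) (i : Fin d) :
    pd i (fun y => h (‖y‖ ^ 2)) x = 2 * h' * x i := by
  rw [pd_comp (f := fun y => ‖y‖ ^ 2) hh (differentiableAt_id.norm_sq ℝ), pd_norm_sq]
  ring

theorem differentiableAt_radial {d : ℕ} {h : ℝ → ℝ} {x : EuclideanSpace ℝ (Fin d)}
    (hh : DifferentiableAt ℝ h (‖x‖ ^ 2)) : DifferentiableAt ℝ (fun y => h (‖y‖ ^ 2)) x :=
  hh.comp x (differentiableAt_id.norm_sq ℝ)

theorem differentiableAt_coord {d : ℕ} (i : Fin d) (x : EuclideanSpace ℝ (Fin d)) :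
    DifferentiableAt ℝ (fun y : EuclideanSpace ℝ (Fin d) => y i) x :=
  (EuclideanSpace.proj (𝕜 := ℝ) i).differentiableAt

/-- The divergence of a radial vector field. -/
theorem sum_pd_radial_field {d : ℕ} {k : ℝ → ℝ} {k' : ℝ} {x : EuclideanSpace ℝ (Fin d)}
    (hk : HasDerivAt k k' (‖x‖ ^ 2)) :
    ∑ i, pd i (fun y => k (‖y‖ ^ 2) * y i) x = d * k (‖x‖ ^ 2) + 2 * ‖x‖ ^ 2 * k' := by
  have h : ∀ i, pd i (fun y => k (‖y‖ ^ 2) * y i) x = k (‖x‖ ^ 2) + 2 * k' * x i ^ 2 := fun i => by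
    rw [pd_mul (differentiableAt_radial hk.differentiableAt) (differentiableAt_coord i x),
      pd_radial hk, pd_coord]
    simp
    ring
  simp only [h, Finset.sum_add_distrib, ← Finset.mul_sum, ← EuclideanSpace.real_norm_sq_eq]
  simp
  ring

/-! ### Conformally flat weighted spaces -/

namespace WeightedSpace

/-- `X` has the cometric `𝔤^{ij} = q δ^{ij}`, and `w` is the Euclidean gradient of `log q / 2`. -/
structure IsConformallyFlat {d : ℕ} (X : WeightedSpace d) (q : EuclideanSpace ℝ (Fin d) → ℝ)
    (w : Fin d → EuclideanSpace ℝ (Fin d) → ℝ) : Prop where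
  cometric_eq : ∀ x ∈ X.carrier, X.cometric x = q x • (1 : Matrix (Fin d) (Fin d) ℝ)
  pos : ∀ x ∈ X.carrier, 0 < q x
  differentiableAt : ∀ x ∈ X.carrier, DifferentiableAt ℝ q x
  pd_eq : ∀ x ∈ X.carrier, ∀ i, pd i q x = 2 * q x * w i x
  differentiableAt_grad : ∀ x ∈ X.carrier, ∀ i, DifferentiableAt ℝ (w i) x

namespace IsConformallyFlat

variable {d : ℕ} {X : WeightedSpace d} {q : EuclideanSpace ℝ (Fin d) → ℝ}
  {w : Fin d → EuclideanSpace ℝ (Fin d) → ℝ} {x : EuclideanSpace ℝ (Fin d)}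

theorem cometric_apply (h : X.IsConformallyFlat q w) (hx : x ∈ X.carrier) (i j : Fin d) :
    X.cometric x i j = if i = j then q x else 0 := by
  rw [h.cometric_eq x hx]
  simp [Matrix.one_apply]

theorem metric_eq (h : X.IsConformallyFlat q w) (hx : x ∈ X.carrier) :
    X.metric x = (q x)⁻¹ • (1 : Matrix (Fin d) (Fin d) ℝ) := by
  unfold metric
  rw [h.cometric_eq x hx]
  refine Matrix.inv_eq_right_inv ?_
  rw [smul_mul_smul_comm, mul_inv_cancel₀ (h.pos x hx).ne', one_smul, one_mul]

theorem metric_apply (h : X.IsConformallyFlat q w) (hx : x ∈ X.carrier) (i j : Fin d) :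
    X.metric x i j = (if i = j then 1 else 0) * (q x)⁻¹ := by
  rw [h.metric_eq hx]
  simp [Matrix.one_apply]

theorem eventually_mem (hx : x ∈ X.carrier) : ∀ᶠ y in 𝓝 x, y ∈ X.carrier :=
  X.isOpen_carrier.mem_nhds hx

theorem pd_metric (h : X.IsConformallyFlat q w) (hx : x ∈ X.carrier) (i j k : Fin d) :
    pd k (fun y => X.metric y i j) x = (if i = j then 1 else 0) * (-2 * (q x)⁻¹ * w k x) := by
  have hq := h.pos x hx
  rw [pd_congr ((eventually_mem hx).mono fun y hy => h.metric_apply hy i j),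
    pd_const_mul ((h.differentiableAt x hx).fun_inv hq.ne'),
    pd_comp (hasDerivAt_inv hq.ne') (h.differentiableAt x hx), h.pd_eq x hx]
  congr 1
  field_simp

/-- The factor `q` of the cometric cancels the `q⁻¹` in the derivatives of the metric. The symbols
are linear in `w` with constant coefficients, so the curvature involves only `w` and its first
derivatives. -/
theorem christoffel_eq (h : X.IsConformallyFlat q w) (hx : x ∈ X.carrier) (k i j : Fin d) :
    X.christoffel k i j x = -(if k = i then 1 else 0) * w j x + (-(if k = j then 1 else 0) * w i x
      + (if i = j then 1 else 0) * w k x) := by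
  have hq := h.pos x hx
  unfold christoffel
  simp only [h.pd_metric hx, h.cometric_apply hx]
  -- The cometric is diagonal, so only `l = k` contributes.
  rw [Finset.sum_eq_single k (by intro l _ hl; simp [hl.symm]) (by simp)]
  simp only [if_true, eq_comm (a := j) (b := k), eq_comm (a := i) (b := k)]
  field_simp
  ring

theorem pd_christoffel (h : X.IsConformallyFlat q w) (hx : x ∈ X.carrier) (k i j l : Fin d) :
    pd l (X.christoffel k i j) x = -(if k = i then 1 else 0) * pd l (w j) x
      + (-(if k = j then 1 else 0) * pd l (w i) x + (if i = j then 1 else 0) * pd l (w k) x) := by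
  have hw := h.differentiableAt_grad x hx
  rw [pd_congr ((eventually_mem hx).mono fun y hy => h.christoffel_eq hy k i j),
    pd_add ((hw j).const_mul _) (((hw i).const_mul _).fun_add ((hw k).const_mul _)),
    pd_add ((hw i).const_mul _) ((hw k).const_mul _),
    pd_const_mul (hw j), pd_const_mul (hw i), pd_const_mul (hw k)]

/-- This is the classical conformal change formula for `e^{2φ} δ` with `φ = -(log q)/2`, that is `∇φ
= -w`. -/
theorem scalarCurvature_eq (h : X.IsConformallyFlat q w) (hx : x ∈ X.carrier) :
    X.scalarCurvature x = q x * (2 * (d - 1) * ∑ i, pd i (w i) x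
      - (d - 1) * (d - 2) * ∑ i, w i x ^ 2) := by
  unfold scalarCurvature ricci riemann
  simp only [h.cometric_apply hx, h.pd_christoffel hx, h.christoffel_eq hx]
  simp only [ite_mul, zero_mul, Finset.sum_ite_eq, Finset.mem_univ, if_true, ← Finset.mul_sum]
  congr 1
  -- Every Kronecker delta is contracted; its full trace produces the factors `d`.
  simp only [mul_add, add_mul, neg_mul, mul_neg, ite_mul, mul_ite, one_mul, zero_mul, mul_zero, Finset.sum_add_distrib, Finset.sum_sub_distrib, Finset.sum_neg_distrib,
    Finset.sum_ite_eq, Finset.sum_ite_eq', Finset.mem_univ, if_true, Finset.sum_const,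
    Finset.card_univ, Fintype.card_fin, nsmul_eq_mul, Finset.sum_ite_irrel, ← Finset.mul_sum]
  simp only [sq]
  ring

theorem sqrt_det_metric (h : X.IsConformallyFlat q w) (hx : x ∈ X.carrier) :
    √(X.metric x).det = √((q x)⁻¹ ^ d) := by
  rw [h.metric_eq hx, Matrix.det_smul]
  simp

/-- Here `√(det g) q = q^{1 - d/2}`, whose gradient is `-(d - 2) q^{1 - d/2} w`; this is the drift
term. The gradient of `f` enters through a field `v`, so that second derivatives of `f` are first
derivatives of explicit functions. -/
theorem laplaceBeltrami_eq (h : X.IsConformallyFlat q w) (hx : x ∈ X.carrier)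
    {f : EuclideanSpace ℝ (Fin d) → ℝ} {v : Fin d → EuclideanSpace ℝ (Fin d) → ℝ}
    (hf : ∀ y ∈ X.carrier, ∀ i, pd i f y = v i y) (hv : ∀ i, DifferentiableAt ℝ (v i) x) :
    X.laplaceBeltrami f x
      = q x * (∑ i, pd i (v i) x - (d - 2) * ∑ i, w i x * v i x) := by
  have hq := h.pos x hx
  have hdq := h.differentiableAt x hx
  set V : ℝ := √((q x)⁻¹ ^ d) with hV
  have hV0 : 0 < V := Real.sqrt_pos.2 (by positivity)
  have hVV : V * V = (q x)⁻¹ ^ d := Real.mul_self_sqrt (by positivity)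
  have hd1 : HasDerivAt (fun s : ℝ => √(s⁻¹ ^ d)) (-(d / 2) * V / q x) (q x) := by
    have := (((hasDerivAt_inv hq.ne').pow d).sqrt
      (by simp only [Pi.pow_apply]; positivity))
    refine this.congr_deriv ?_
    simp only [Pi.pow_apply]
    rw [← hV]
    -- The power rule produces the truncated exponent `d - 1`, so `d = 0` is separate.
    rcases d with _ | m
    · simp
    · rw [div_eq_iff (by positivity)]
      have e : -(((m + 1 : ℕ) : ℝ) / 2) * V / q x * (2 * V)
        = -((m + 1 : ℕ) : ℝ) / q x * (V * V) := by ring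
      rw [e, hVV, Nat.add_sub_cancel, pow_succ]
      ring
  have hdV : DifferentiableAt ℝ (fun y => √((q y)⁻¹ ^ d)) x := hd1.differentiableAt.comp x hdq
  have key : ∀ i, pd i (fun y => ∑ j, √(X.metric y).det * X.cometric y i j * pd j f y) x
      = V * (q x * (pd i (v i) x - (d - 2) * (w i x * v i x))) := fun i => by
    have e : (fun y => ∑ j, √(X.metric y).det * X.cometric y i j * pd j f y)
        =ᶠ[𝓝 x] fun y => √((q y)⁻¹ ^ d) * (q y * v i y) := by
      filter_upwards [eventually_mem hx] with y hy
      simp only [h.sqrt_det_metric hy, h.cometric_apply hy, hf y hy]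
      simp [mul_assoc]
    rw [pd_congr e, pd_mul hdV (hdq.fun_mul (hv i)), pd_mul hdq (hv i), pd_comp hd1 hdq,
      h.pd_eq x hx]
    rw [← hV]
    field_simp
    ring
  unfold laplaceBeltrami
  simp only [key, h.sqrt_det_metric hx, ← hV, ← Finset.mul_sum, Finset.sum_sub_distrib]
  field_simp

theorem carreDuChamp_eq (h : X.IsConformallyFlat q w) (hx : x ∈ X.carrier)
    (f : EuclideanSpace ℝ (Fin d) → ℝ) :
    X.carreDuChamp f x = q x * ∑ i, pd i f x ^ 2 := by
  unfold carreDuChamp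
  simp only [h.cometric_apply hx, ite_mul, zero_mul, Finset.sum_ite_eq, Finset.mem_univ, if_true,
    Finset.mul_sum]
  exact Finset.sum_congr rfl fun i _ => by ring

end IsConformallyFlat

end WeightedSpace

/-! ### Radial weighted spaces -/

theorem sum_radial_mul {d : ℕ} (x : EuclideanSpace ℝ (Fin d)) (s t : ℝ) :
    ∑ i, s * x i * (t * x i) = s * t * ‖x‖ ^ 2 := by
  rw [EuclideanSpace.real_norm_sq_eq, Finset.mul_sum]
  exact Finset.sum_congr rfl fun i _ => by ring

namespace WeightedSpace

/-- `S_γ` for a cometric `q δ^{ij}` and a weight `W` with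
`∇q = 2 q (1 - α c) x / |x|²` and `∇W = -(n - d) α c x / |x|²`, where `c` is a radial function with
`c' = -2 α σ / |x|²` (with respect to `|x|²`), `c² = 1 - 4 σ` and `q σ = ε |x|² / 4`. -/
theorem invariantS_of_radial {d : ℕ} (hd : 3 ≤ d) {X : WeightedSpace d}
    {q : EuclideanSpace ℝ (Fin d) → ℝ} {n α ε : ℝ} {c σ : ℝ → ℝ}
    (hn : (d : ℝ) < n) (hα : α ≠ 0) (hX0 : ∀ x ∈ X.carrier, x ≠ 0)
    (h : X.IsConformallyFlat q (fun i y => (1 - α * c (‖y‖ ^ 2)) / ‖y‖ ^ 2 * y i))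
    (hc : ∀ x ∈ X.carrier, HasDerivAt c (-2 * α * σ (‖x‖ ^ 2) / ‖x‖ ^ 2) (‖x‖ ^ 2))
    (hcσ : ∀ x ∈ X.carrier, c (‖x‖ ^ 2) ^ 2 = 1 - 4 * σ (‖x‖ ^ 2))
    (hqσ : ∀ x ∈ X.carrier, q x * σ (‖x‖ ^ 2) = ε / 4 * ‖x‖ ^ 2)
    (hW : ∀ x ∈ X.carrier, ∀ i,
      pd i X.weight x = (-(n - d) * α * c (‖x‖ ^ 2)) / ‖x‖ ^ 2 * x i)
    {x : EuclideanSpace ℝ (Fin d)} (hx : x ∈ X.carrier) :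
    X.invariantS n
      (-(2 * (d - 1) / (α ^ 2 * (n - d) * (n - 2))) * ((d - 2) - (n - 2) * α ^ 2)) x
      = ε * (n * (n - 2) / 4 * α ^ 2) := by
  have hd' : (3 : ℝ) ≤ d := by exact_mod_cast hd
  have hρ : ‖x‖ ^ 2 ≠ 0 := pow_ne_zero 2 (norm_ne_zero_iff.2 (hX0 x hx))
  have hn2 : n - 2 ≠ 0 := by linarith
  have hnd : n - d ≠ 0 := by linarith
  have hd1 : (d : ℝ) - 1 ≠ 0 := by linarith
  have hd2 : (d : ℝ) - 2 ≠ 0 := by linarith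
  have hw1 : HasDerivAt (fun r => (1 - α * c r) / r) _ (‖x‖ ^ 2) :=
    (((hc x hx).const_mul α).const_sub 1).div (hasDerivAt_id _) hρ
  have hv1 : HasDerivAt (fun r => (-(n - d) * α * c r) / r) _ (‖x‖ ^ 2) :=
    ((hc x hx).const_mul (-(n - d) * α)).div (hasDerivAt_id _) hρ
  -- At `γ₀` the terms `(n - 2)α²` cancel in the denominator of `θ_n`, leaving
  -- `4(d-1)(d-2)/(α²(n-2))`, which is nonzero since `d ≥ 3`.
  have hθ : thetaCoeff d n
      (-(2 * (d - 1) / (α ^ 2 * (n - d) * (n - 2))) * ((d - 2) - (n - 2) * α ^ 2))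
      = (n - 2) ^ 2 * α ^ 2 / (4 * (d - 1) * (d - 2)) := by
    unfold thetaCoeff
    have : 4 * ((d : ℝ) - 1) - 2 *
        (-(2 * (d - 1) / (α ^ 2 * (n - d) * (n - 2))) * ((d - 2) - (n - 2) * α ^ 2)) * (n - d)
        = 4 * (d - 1) * (d - 2) / (α ^ 2 * (n - 2)) := by
      field_simp
      ring
    rw [this]
    field_simp
  unfold invariantS
  rw [h.scalarCurvature_eq hx, h.laplaceBeltrami_eq hx hW fun i =>
      (differentiableAt_radial hv1.differentiableAt).fun_mul (differentiableAt_coord i x),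
    h.carreDuChamp_eq hx, sum_pd_radial_field hw1, sum_pd_radial_field hv1, sum_radial_mul, hθ]
  simp only [hW x hx, sq (_ * x.ofLp _), sum_radial_mul]
  have h1 := hcσ x hx
  have h2 := hqσ x hx
  -- The derivatives are already expressed through `c` and `σ`, so the claim is now a rational
  -- identity in the values of `c`, `σ`, `q`, `ρ`.
  generalize c (‖x‖ ^ 2) = C at *
  generalize σ (‖x‖ ^ 2) = S at *
  generalize ‖x‖ ^ 2 = ρ at *
  have hq : q x = q x / ρ * ρ := by field_simp
  have h3 : q x / ρ * S = ε / 4 := by rw [div_mul_eq_mul_div, h2]; field_simp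
  generalize q x / ρ = T at *
  rw [hq]
  have h4 : S = (1 - C ^ 2) / 4 := by linarith
  -- Eliminating `ε` and `σ` in favour of `T` and `C` leaves an identity with no side relation.
  have h5 : ε = T * (1 - C ^ 2) := by rw [h4] at h3; linarith
  unfold betaCoeff
  rw [h4, h5]
  field_simp
  ring

/-- Since `dV_g = q^{-d/2} dx`, the density `m` equals `e^{-W} q^{-d/2}`; uniqueness of the weight
identifies the chosen one with this explicit solution. -/
theorem weight_ofScalar {d : ℕ} {U : Set (EuclideanSpace ℝ (Fin d))}
    (hU : IsOpen U) {q m : EuclideanSpace ℝ (Fin d) → ℝ} (hq : ContDiffOn ℝ ∞ q U)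
    (hq0 : ∀ x ∈ U, 0 < q x) (hm : ContDiffOn ℝ ∞ m U) (hm0 : ∀ x ∈ U, 0 < m x) :
    EqOn (ofScalar U hU q m hq hq0 hm hm0).weight
      (fun y => (-1) * Real.log (m y) + (-(d / 2 : ℝ)) * Real.log (q y)) U := by
  set X := ofScalar U hU q m hq hq0 hm hm0
  refine X.weight_unique ((isWeight_iff X.isOpen_carrier X.contDiffOn_cometric
    X.posDef_cometric).2 ⟨?_, withDensity_congr_ae ?_⟩)
  · exact (contDiffOn_const.mul (hm.log fun y hy => (hm0 y hy).ne')).add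
      (contDiffOn_const.mul (hq.log fun y hy => (hq0 y hy).ne'))
  · filter_upwards [ae_restrict_mem hU.measurableSet] with y hy
    have hqd : 0 < q y ^ d := pow_pos (hq0 y hy) d
    have hdet : (X.cometric y)⁻¹.det = (q y ^ d)⁻¹ := by
      change (q y • (1 : Matrix (Fin d) (Fin d) ℝ))⁻¹.det = _
      rw [Matrix.det_nonsing_inv, Ring.inverse_eq_inv', Matrix.det_smul]
      simp
    have hexp : Real.exp (-((-1) * Real.log (m y) + (-(d / 2 : ℝ)) * Real.log (q y)))
        = m y * √(q y ^ d) := by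
      have : -((-1) * Real.log (m y) + (-(d / 2 : ℝ)) * Real.log (q y))
          = Real.log (m y * √(q y ^ d)) := by
        rw [Real.log_mul (hm0 y hy).ne' (Real.sqrt_pos.2 hqd).ne', Real.log_sqrt hqd.le,
          Real.log_pow]
        ring
      rw [this, Real.exp_log (mul_pos (hm0 y hy) (Real.sqrt_pos.2 hqd))]
    rw [hexp, hdet, Real.sqrt_inv, mul_left_comm, inv_mul_cancel₀ (Real.sqrt_pos.2 hqd).ne',
      mul_one]

/-- `S_{γ₀}` for the cometric `κ |x|^{2(1-α)} (1 + ε |x|^{2α})² δ^{ij}` and the measure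
`K |x|^{nα-d} (1 + ε |x|^{2α})^{-n} dx`. -/
theorem invariantS_ofScalar {d : ℕ} (hd : 3 ≤ d) {U : Set (EuclideanSpace ℝ (Fin d))}
    (hU : IsOpen U) {q m : EuclideanSpace ℝ (Fin d) → ℝ} (hq : ContDiffOn ℝ ∞ q U)
    (hq0 : ∀ x ∈ U, 0 < q x) (hm : ContDiffOn ℝ ∞ m U) (hm0 : ∀ x ∈ U, 0 < m x)
    {n α ε κ K : ℝ} (hn : (d : ℝ) < n) (hα : α ≠ 0) (hεκ : ε * κ = ε / 4)
    (hU0 : ∀ x ∈ U, x ≠ 0) (hUε : ∀ x ∈ U, 0 < 1 + ε * (‖x‖ ^ 2) ^ α)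
    (hqU : ∀ x ∈ U, q x = κ * ((‖x‖ ^ 2) ^ (1 - α) * (1 + ε * (‖x‖ ^ 2) ^ α) ^ 2))
    (hmU : ∀ x ∈ U, m x = K * ((‖x‖ ^ 2) ^ ((n * α - d) / 2) / (1 + ε * (‖x‖ ^ 2) ^ α) ^ n))
    {x : EuclideanSpace ℝ (Fin d)} (hx : x ∈ U) :
    (ofScalar U hU q m hq hq0 hm hm0).invariantS n
      (-(2 * (d - 1) / (α ^ 2 * (n - d) * (n - 2))) * ((d - 2) - (n - 2) * α ^ 2)) x
      = ε * (n * (n - 2) / 4 * α ^ 2) := by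
  have hρ : ∀ y ∈ U, 0 < ‖y‖ ^ 2 := fun y hy => pow_pos (norm_pos_iff.2 (hU0 y hy)) 2
  have hpow : ∀ y ∈ U, ∀ s : ℝ,
      HasDerivAt (fun r : ℝ => r ^ s) (s * ((‖y‖ ^ 2) ^ s / ‖y‖ ^ 2)) (‖y‖ ^ 2) := fun y hy s => by
    rw [← Real.rpow_sub_one (hρ y hy).ne']
    exact Real.hasDerivAt_rpow_const (Or.inl (hρ y hy).ne')
  have hD : ∀ y ∈ U, HasDerivAt (fun r : ℝ => 1 + ε * r ^ α)
      (ε * (α * ((‖y‖ ^ 2) ^ α / ‖y‖ ^ 2))) (‖y‖ ^ 2) := fun y hy =>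
    ((hpow y hy α).const_mul ε).const_add 1
  -- The derivative is recorded as `q` times a logarithmic derivative, using `2 ε ρ^α/(1 + ε ρ^α) =
  -- 1 - c`; likewise for `m` below.
  have hQ : ∀ y ∈ U, HasDerivAt (fun r : ℝ => κ * (r ^ (1 - α) * (1 + ε * r ^ α) ^ 2))
      (q y * ((1 - α * ((1 - ε * (‖y‖ ^ 2) ^ α) / (1 + ε * (‖y‖ ^ 2) ^ α))) / ‖y‖ ^ 2))
      (‖y‖ ^ 2) := fun y hy => by
    refine (((hpow y hy _).mul ((hD y hy).pow 2)).const_mul κ).congr_deriv ?_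
    have h1 := (hρ y hy).ne'
    have h2 := (hUε y hy).ne'
    rw [hqU y hy]
    simp only [Pi.pow_apply]
    field_simp
    ring
  have hM : ∀ y ∈ U, HasDerivAt
      (fun r : ℝ => K * (r ^ ((n * α - d) / 2) / (1 + ε * r ^ α) ^ n))
      (m y * ((n * α * ((1 - ε * (‖y‖ ^ 2) ^ α) / (1 + ε * (‖y‖ ^ 2) ^ α)) - d)
        / (2 * ‖y‖ ^ 2))) (‖y‖ ^ 2) := fun y hy => by
    have h1 := (hρ y hy).ne'
    have h2 := (hUε y hy).ne'
    have h3 := (Real.rpow_pos_of_pos (hUε y hy) n).ne'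
    refine (((hpow y hy _).div ((hD y hy).rpow_const (p := n) (Or.inl h2)) h3).const_mul
      K).congr_deriv ?_
    rw [hmU y hy, Real.rpow_sub_one h2]
    field_simp
    ring
  have hev : ∀ y ∈ U, ∀ᶠ z in 𝓝 y, z ∈ U := fun y hy => hU.mem_nhds hy
  have hdq : ∀ y ∈ U, DifferentiableAt ℝ q y := fun y hy =>
    (hq.contDiffAt (hU.mem_nhds hy)).differentiableAt (by simp)
  have hdm : ∀ y ∈ U, DifferentiableAt ℝ m y := fun y hy =>
    (hm.contDiffAt (hU.mem_nhds hy)).differentiableAt (by simp)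
  have hpq : ∀ y ∈ U, ∀ i, pd i q y = 2 * q y *
      ((1 - α * ((1 - ε * (‖y‖ ^ 2) ^ α) / (1 + ε * (‖y‖ ^ 2) ^ α))) / ‖y‖ ^ 2 * y i) :=
    fun y hy i => by
      rw [pd_congr ((hev y hy).mono hqU), pd_radial (hQ y hy)]
      ring
  have hpm : ∀ y ∈ U, ∀ i, pd i m y = m y *
      ((n * α * ((1 - ε * (‖y‖ ^ 2) ^ α) / (1 + ε * (‖y‖ ^ 2) ^ α)) - d) / ‖y‖ ^ 2 * y i) :=
    fun y hy i => by
      rw [pd_congr ((hev y hy).mono hmU), pd_radial (hM y hy)]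
      ring
  have hc : ∀ y ∈ U, HasDerivAt (fun r : ℝ => (1 - ε * r ^ α) / (1 + ε * r ^ α))
      (-2 * α * (ε * (‖y‖ ^ 2) ^ α / (1 + ε * (‖y‖ ^ 2) ^ α) ^ 2) / ‖y‖ ^ 2) (‖y‖ ^ 2) :=
    fun y hy => by
      refine ((((hpow y hy α).const_mul ε).const_sub 1).div (hD y hy)
        (hUε y hy).ne').congr_deriv ?_
      have h1 := (hρ y hy).ne'
      have h2 := (hUε y hy).ne'
      field_simp
      ring
  set X := ofScalar U hU q m hq hq0 hm hm0 with hX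
  have hweight : EqOn X.weight
      (fun y => (-1) * Real.log (m y) + (-(d / 2 : ℝ)) * Real.log (q y)) U :=
    weight_ofScalar hU hq hq0 hm hm0
  refine invariantS_of_radial (X := X) (q := q) (c := fun r => (1 - ε * r ^ α) / (1 + ε * r ^ α))
    (σ := fun r => ε * r ^ α / (1 + ε * r ^ α) ^ 2) hd hn hα hU0 ?_ hc ?_ ?_ ?_ hx
  · refine ⟨fun _ _ => rfl, hq0, hdq, hpq, fun y hy i => ?_⟩
    refine (differentiableAt_radial (h := fun r => (1 - α * ((1 - ε * r ^ α) / (1 + ε * r ^ α))) / r)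
      ?_).fun_mul (differentiableAt_coord i y)
    exact (((hc y hy).differentiableAt.const_mul α).const_sub 1).fun_div differentiableAt_id
      (hρ y hy).ne'
  · intro y hy
    have := (hUε y hy).ne'
    field_simp
    ring
  · intro y hy
    have h2 := (hUε y hy).ne'
    simp only [hqU y hy]
    -- The factors `(1 + ε ρ^α)²` of `q` and `σ` cancel, so only powers of `ρ` remain.
    have : (‖y‖ ^ 2) ^ (1 - α) * (‖y‖ ^ 2) ^ α = ‖y‖ ^ 2 := by
      rw [← Real.rpow_add (hρ y hy), sub_add_cancel, Real.rpow_one]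
    calc _ = ε * κ * ((‖y‖ ^ 2) ^ (1 - α) * (‖y‖ ^ 2) ^ α) := by field_simp
      _ = _ := by rw [this, hεκ]
  · intro y hy i
    -- The two logarithmic gradients add up through `-(nαc - d) - d(1 - αc) = -(n - d)αc`.
    rw [pd_congr ((hev y hy).mono hweight),
      pd_add (((hdm y hy).log (hm0 y hy).ne').const_mul _)
        (((hdq y hy).log (hq0 y hy).ne').const_mul _),
      pd_const_mul ((hdm y hy).log (hm0 y hy).ne'), pd_const_mul ((hdq y hy).log (hq0 y hy).ne'),
      pd_comp (Real.hasDerivAt_log (hm0 y hy).ne') (hdm y hy),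
      pd_comp (Real.hasDerivAt_log (hq0 y hy).ne') (hdq y hy), hpm y hy, hpq y hy]
    have h1 := (hm0 y hy).ne'
    have h2 := (hq0 y hy).ne'
    have h3 := (hρ y hy).ne'
    have h4 := (hUε y hy).ne'
    field_simp
    ring

end WeightedSpace

/-! ### Parameter identities and the three CKN spaces -/

namespace CKN

theorem cast_lt_n {d : ℕ} {a b : ℝ} (hd : 3 ≤ d) (hab : a < b) (hba : b < a + 1) :
    (d : ℝ) < n d a b := by
  have hd' : (3 : ℝ) ≤ d := by exact_mod_cast hd
  unfold n
  rw [lt_div_iff₀ (by linarith)]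
  nlinarith

/-- Rewrites the density exponent `-bp` as `nα - d`, so that the measure depends on `d`, `n` and `α`
only. -/
theorem n_mul_α {d : ℕ} {a b : ℝ} (hd : 3 ≤ d) (hab : a < b) (hba : b < a + 1) :
    n d a b * α d a b = d - b * p d a b := by
  have hd' : (3 : ℝ) ≤ d := by exact_mod_cast hd
  have h1 : (d : ℝ) - 2 + 2 * (b - a) ≠ 0 := by linarith
  have h2 : 1 + a - b ≠ 0 := by linarith
  unfold n α p
  field_simp
  ring

end CKN

theorem norm_rpow_two_mul {d : ℕ} (x : EuclideanSpace ℝ (Fin d)) (s : ℝ) :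
    ‖x‖ ^ (2 * s) = (‖x‖ ^ 2) ^ s := by
  rw [Real.rpow_mul (norm_nonneg x), Real.rpow_two]

theorem proposition4 (d : ℕ) (hd : 3 ≤ d) (a b : ℝ) (hab : a < b) (hba : b < a + 1)
    (ha : a < ((d : ℝ) - 2) / 2) :
    (∀ x ∈ (CKN.euclidean d a b).carrier,
      (CKN.euclidean d a b).invariantS (CKN.n d a b) (CKN.γ₀ d a b) x = 0) ∧
    (∀ x ∈ (CKN.spherical d a b).carrier,
      (CKN.spherical d a b).invariantS (CKN.n d a b) (CKN.γ₀ d a b) x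
        = CKN.n d a b * (CKN.n d a b - 2) / 4 * CKN.α d a b ^ 2) ∧
    (∀ x ∈ (CKN.hyperbolic d a b (CKN.α_pos hd hab.le hba ha)).carrier,
      (CKN.hyperbolic d a b (CKN.α_pos hd hab.le hba ha)).invariantS
          (CKN.n d a b) (CKN.γ₀ d a b) x
        = -(CKN.n d a b * (CKN.n d a b - 2) / 4 * CKN.α d a b ^ 2)) := by
  have hα := CKN.α_pos hd hab.le hba ha
  have hn := CKN.cast_lt_n hd hab hba
  have hm (x : EuclideanSpace ℝ (Fin d)) :
      ‖x‖ ^ (-(b * CKN.p d a b)) = (‖x‖ ^ 2) ^ ((CKN.n d a b * CKN.α d a b - d) / 2) := by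
    rw [← norm_rpow_two_mul, CKN.n_mul_α hd hab hba]
    congr 1
    ring
  refine ⟨fun x hx => ?_, fun x hx => ?_, fun x hx => ?_⟩
  -- With `ε = 0` the normalisation `εκ = ε/4` puts no condition on `κ`, so `κ = 1` is allowed; the
  -- curved cases force `κ = 1/4`.
  · refine (WeightedSpace.invariantS_ofScalar (ε := 0) (κ := 1) (K := 1) hd _ _ _ _ _ hn hα.ne'
      (by simp) (fun _ hy => hy) (fun y _ => by simp) (fun y _ => ?_) (fun y _ => ?_) hx).trans
      (by ring)
    · simp [norm_rpow_two_mul]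
    · simp [hm]
  · refine (WeightedSpace.invariantS_ofScalar (ε := 1) (κ := 1 / 4) (K := 2 ^ CKN.n d a b) hd
      _ _ _ _ _ hn hα.ne' (by ring) (fun _ hy => hy) (fun y _ => by positivity) (fun y _ => ?_)
      (fun y _ => ?_) hx).trans (by ring)
    · simp only [norm_rpow_two_mul]
      ring
    · simp only [hm, norm_rpow_two_mul, one_mul]
  · refine (WeightedSpace.invariantS_ofScalar (ε := -1) (κ := 1 / 4) (K := 2 ^ CKN.n d a b) hd
      _ _ _ _ _ hn hα.ne' (by ring) (fun _ hy => hy.2) (fun y hy => ?_) (fun y _ => ?_)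
      (fun y _ => ?_) hx).trans (by ring)
    · have := CKN.one_sub_pos hα hy
      rw [norm_rpow_two_mul] at this
      linarith
    · simp only [norm_rpow_two_mul]
      ring
    · simp only [hm, norm_rpow_two_mul, neg_one_mul, ← sub_eq_add_neg]
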